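/- Let $d\ge 2$ and let $\mathcal S=\{|\psi_1\rangle,\dots,|\psi_{d^2}\rangle\}$ be an orthonormal basis of $\mathbb C^d\otimes\mathbb C^d$ consisting of maximally entangled states, i.e. each $|\psi_i\rangle=(U_i\otimes \mathbb I)|\Gamma\rangle$ with $U_i$ unitary and $|\Gamma\rangle=\frac1{\sqrt d}\sum_{j=1}^d|jj\rangle$. Then $\mathcal S$ is $(d^2,2)$-unidentifiable: two distinct states drawn from $\mathcal S$ and shared between Alice and Bob cannot, in general, be perfectly identified by LOCC. Precisely, for every two-element subset $s=\{p,q\}\subset\{1,\dots,d^2\}$ let $$\rho_s=\tfrac12\,|\psi_p\rangle\langle\psi_p|_{A_1B_1}\otimes|\psi_q\rangle\langle\psi_q|_{A_2B_2}+\tfrac12\,|\psi_q\rangle\langle\psi_q|_{A_1B_1}\otimes|\psi_p\rangle\langle\psi_p|_{A_2B_2},$$ a state shared by Alice (who holds $A_1A_2$, with space $\mathbb C^{d^2}$) and Bob (who holds $B_1B_2$, with space $\mathbb C^{d^2}$). Then there is no LOCC measurement $(E_s)_s$, with outcomes the two-element subsets $s$, such that $\operatorname{Tr}(\rho_sE_s)=1$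 for every $s$. Here an LOCC measurement is one implemented by a sequence of rounds, in each of which one party performs a local quantum measurement with finitely many outcomes (possibly changing its finite local dimension) that may depend on all earlier outcomes, and announces its outcome. The number of rounds may be infinite; in that case the measurement is the limit of the POVMs of finite-round protocols, each of which continues the previous one. -/

import Mathlib

open scoped Matrix Kronecker

namespace LocalSubset

/-- A finite-round LOCC protocol for Alice (local space `ℂ^a`) and Bob (local space `ℂ^b`) that ends
with an output in `X`. In each round one party performs a quantum measurement on its own system, with
Kraus operators `K i` satisfying `∑ i, (K i)ᴴ * K i = 1`; the local dimension may change, so local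
ancillas and discarding are covered. The outcome `i` is broadcast, and the rest of the protocol may
depend on it. (A local instrument with several Kraus operators per outcome, local randomness and shared
randomness are obtained by ignoring part of the outcome.) -/
inductive Protocol (X : Type) : ℕ → ℕ → Type
  | output {a b : ℕ} (x : X) : Protocol X a b
  | alice {a b m : ℕ} (a' : Fin m → ℕ) (K : ∀ i, Matrix (Fin (a' i)) (Fin a) ℂ)
      (hK : ∑ i, (K i)ᴴ * K i = 1) (next : ∀ i, Protocol X (a' i) b) : Protocol X a b
  | bob {a b m : ℕ} (b' : Fin m → ℕ) (K : ∀ i, Matrix (Fin (b' i)) (Fin b) ℂ)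
      (hK : ∑ i, (K i)ᴴ * K i = 1) (next : ∀ i, Protocol X a (b' i)) : Protocol X a b

/-- The POVM on `ℂ^a ⊗ ℂ^b` implemented by a finite-round protocol: on a state `ρ`, the output is `x`
with probability `Tr (ρ * T.povm x)`. -/
noncomputable def Protocol.povm {X : Type} [DecidableEq X] :
    {a b : ℕ} → Protocol X a b → X → Matrix (Fin a × Fin b) (Fin a × Fin b) ℂ
  | _, _, .output y, x => if x = y then 1 else 0
  | _, b, .alice _ K _ next, x =>
      ∑ i, (K i ⊗ₖ (1 : Matrix (Fin b) (Fin b) ℂ))ᴴ * (next i).povm x *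
        (K i ⊗ₖ (1 : Matrix (Fin b) (Fin b) ℂ))
  | a, _, .bob _ K _ next, x =>
      ∑ i, ((1 : Matrix (Fin a) (Fin a) ℂ) ⊗ₖ K i)ᴴ * (next i).povm x *
        ((1 : Matrix (Fin a) (Fin a) ℂ) ⊗ₖ K i)

/-- `Extends T T'`: the protocol `T'` first runs `T` and then possibly continues with further rounds
(which may revise the provisional output of `T`). -/
inductive Protocol.Extends {X : Type} : {a b : ℕ} → Protocol X a b → Protocol X a b → Prop
  | output {a b : ℕ} (x : X) (T : Protocol X a b) : Extends (.output x) T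
  | alice {a b m : ℕ} (a' : Fin m → ℕ) (K : ∀ i, Matrix (Fin (a' i)) (Fin a) ℂ)
      (hK : ∑ i, (K i)ᴴ * K i = 1) (next next' : ∀ i, Protocol X (a' i) b)
      (h : ∀ i, Extends (next i) (next' i)) : Extends (.alice a' K hK next) (.alice a' K hK next')
  | bob {a b m : ℕ} (b' : Fin m → ℕ) (K : ∀ i, Matrix (Fin (b' i)) (Fin b) ℂ)
      (hK : ∑ i, (K i)ᴴ * K i = 1) (next next' : ∀ i, Protocol X a (b' i))
      (h : ∀ i, Extends (next i) (next' i)) : Extends (.bob b' K hK next) (.bob b' K hK next')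

/-- A measurement on `ℂ^a ⊗ ℂ^b` is LOCC if it is implemented by a possibly infinite-round protocol:
a sequence of finite-round protocols, each continuing the previous one, whose POVMs converge to it.
A constant sequence gives the finite-round measurements. -/
def IsLOCC {X : Type} [DecidableEq X] {a b : ℕ}
    (E : X → Matrix (Fin a × Fin b) (Fin a × Fin b) ℂ) : Prop :=
  ∃ T : ℕ → Protocol X a b, (∀ t, (T t).Extends (T (t + 1))) ∧
    ∀ x, Filter.Tendsto (fun t => (T t).povm x) Filter.atTop (nhds (E x))

/-- The vector `φ 0 ⊗ ⋯ ⊗ φ (k - 1)` of `k` bipartite pure states in `ℂ^d ⊗ ℂ^d`, seen as a bipartite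
vector in `ℂ^(d^k) ⊗ ℂ^(d^k)`: Alice holds all the first factors and Bob all the second ones. The
basis of `ℂ^(d^k) = (ℂ^d)^{⊗k}` is labelled through the standard bijection `(Fin k → Fin d) ≃ Fin (d^k)`. -/
noncomputable def sharedVector {d k : ℕ} (φ : Fin k → EuclideanSpace ℂ (Fin d × Fin d)) :
    Fin (d ^ k) × Fin (d ^ k) → ℂ :=
  fun p => ∏ j, φ j (finFunctionFinEquiv.symm p.1 j, finFunctionFinEquiv.symm p.2 j)

/-- The state shared when the `k`-element subset `{ψ i | i ∈ s}` is distributed without revealing the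
identities or the order of its elements: the equal mixture of the products over all orderings of `s`. -/
noncomputable def subsetState {d n : ℕ} (k : ℕ) (ψ : Fin n → EuclideanSpace ℂ (Fin d × Fin d))
    (s : Finset (Fin n)) : Matrix (Fin (d ^ k) × Fin (d ^ k)) (Fin (d ^ k) × Fin (d ^ k)) ℂ :=
  (1 / (k.factorial : ℂ)) • ∑ σ : Fin k ≃ s,
    Matrix.vecMulVec (sharedVector fun j => ψ (σ j)) (star (sharedVector fun j => ψ (σ j)))

/-- `(n, k)`-identifiability of the states `ψ 0, …, ψ (n - 1)` in `ℂ^d ⊗ ℂ^d`: some LOCC measurement,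
whose outcomes are the `k`-element subsets, names the distributed subset with probability one,
whichever `k`-element subset it is. -/
def IsLocallyIdentifiable {d n : ℕ} (ψ : Fin n → EuclideanSpace ℂ (Fin d × Fin d)) (k : ℕ) : Prop :=
  ∃ E : {s : Finset (Fin n) // s.card = k} →
      Matrix (Fin (d ^ k) × Fin (d ^ k)) (Fin (d ^ k) × Fin (d ^ k)) ℂ,
    IsLOCC E ∧
      ∀ s : {s : Finset (Fin n) // s.card = k}, (subsetState k ψ s.1 * E s).trace = 1

/-- The standard maximally entangled vector `Γ = d^(-1/2) ∑ j, |j j⟩` in `ℂ^d ⊗ ℂ^d`. -/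
noncomputable def Gam (d : ℕ) : Fin d × Fin d → ℂ :=
  fun p => if p.1 = p.2 then ((1 / Real.sqrt d : ℝ) : ℂ) else 0

/-- A vector in `ℂ^d ⊗ ℂ^d` is a maximally entangled state if it is `(U ⊗ 1) Γ` for a unitary `U`. -/
def IsMaximallyEntangled {d : ℕ} (ψ : EuclideanSpace ℂ (Fin d × Fin d)) : Prop :=
  ∃ U ∈ Matrix.unitaryGroup (Fin d) ℂ,
    ψ = WithLp.toLp 2 ((U ⊗ₖ (1 : Matrix (Fin d) (Fin d) ℂ)) *ᵥ Gam d)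

end LocalSubset

/-!
Every effect of an LOCC measurement is a limit of sums of products `A ⊗ B` of positive semidefinite
operators. A maximally entangled state of `ℂ^D ⊗ ℂ^D` is the vectorization of a matrix `V` with
`V Vᴴ = 1 / D`, so it is accepted by `A ⊗ B` with probability
`Tr (Vᴴ B V Aᵀ) ≤ Tr (Vᴴ B V) Tr A = Tr (A ⊗ B) / D`. A product of `k` maximally entangled states of
`ℂ^d ⊗ ℂ^d` is maximally entangled between Alice and Bob with `D = d ^ k`. As the effects sum to the
identity, of trace `D ^ 2`, the success probabilities of an LOCC measurement over all `k`-element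
subsets of `n` such states sum to at most `d ^ k`, whereas perfect identification requires the sum
`n.choose k`. For `n = d ^ 2` and `k = 2` the latter is larger.
-/

namespace LocalSubset

open Matrix Filter
open scoped ComplexOrder MatrixOrder

section TraceInequality

open scoped Matrix.Norms.Frobenius

variable {𝕜 m n : Type*} [RCLike 𝕜] [Fintype m] [Fintype n]

theorem trace_conjTranspose_mul_self_eq_frobenius_norm_sq (A : Matrix m n 𝕜) :
    (Aᴴ * A).trace = ((‖A‖ ^ 2 : ℝ) : 𝕜) := by
  have norm_sq : ‖A‖ ^ 2 = ∑ i, ∑ j, ‖A i j‖ ^ 2 := by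
    rw [frobenius_norm_def, ← Real.sqrt_eq_rpow, Real.sq_sqrt (by positivity)]
    simp only [Real.rpow_two]
  rw [norm_sq, Finset.sum_comm]
  simp only [trace, diag_apply, mul_apply, conjTranspose_apply, RCLike.star_def, RCLike.conj_mul,
    RCLike.ofReal_sum, RCLike.ofReal_pow]

theorem trace_mul_le_trace_mul_trace {A B : Matrix n n 𝕜} (hA : A.PosSemidef)
    (hB : B.PosSemidef) : (A * B).trace ≤ A.trace * B.trace := by
  classical
  obtain ⟨P, rfl⟩ := CStarAlgebra.nonneg_iff_eq_star_mul_self.1 hA.nonneg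
  obtain ⟨Q, rfl⟩ := CStarAlgebra.nonneg_iff_eq_star_mul_self.1 hB.nonneg
  simp only [star_eq_conjTranspose]
  have trace_cycle : (Pᴴ * P * (Qᴴ * Q)).trace = ((P * Qᴴ)ᴴ * (P * Qᴴ)).trace := by
    rw [conjTranspose_mul, conjTranspose_conjTranspose, ← Matrix.mul_assoc, trace_mul_comm]
    simp only [Matrix.mul_assoc]
  have norm_le : ‖P * Qᴴ‖ ≤ ‖P‖ * ‖Q‖ :=
    (frobenius_norm_mul P Qᴴ).trans_eq (by rw [frobenius_norm_conjTranspose])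
  rw [trace_cycle]
  simp only [trace_conjTranspose_mul_self_eq_frobenius_norm_sq]
  rw [← RCLike.ofReal_mul, RCLike.ofReal_le_ofReal, ← mul_pow]
  gcongr

end TraceInequality

section Kronecker

variable {ι R l m n p : Type*}

theorem sum_kronecker [Semiring R] (s : Finset ι) (A : ι → Matrix l m R) (B : Matrix n p R) :
    (∑ i ∈ s, A i) ⊗ₖ B = ∑ i ∈ s, A i ⊗ₖ B :=
  map_sum ((kroneckerBilinear (R := ℕ)).flip B) A s

theorem kronecker_sum [Semiring R] (s : Finset ι) (A : Matrix l m R) (B : ι → Matrix n p R) :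
    A ⊗ₖ (∑ i ∈ s, B i) = ∑ i ∈ s, A ⊗ₖ B i :=
  map_sum (kroneckerBilinear (R := ℕ) A) B s

variable [CommSemiring R] [StarRing R]

theorem star_vec_dotProduct_kronecker_mulVec_vec [Fintype m] [Fintype n]
    (A : Matrix m m R) (B : Matrix n n R) (V : Matrix n m R) :
    star (vec V) ⬝ᵥ (A ⊗ₖ B) *ᵥ vec V = (Vᴴ * B * V * Aᵀ).trace := by
  rw [kronecker_mulVec_vec, star_vec_dotProduct_vec]
  simp only [Matrix.mul_assoc]

variable [Fintype ι] [DecidableEq m] [DecidableEq n]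

theorem sum_conjTranspose_mul_kronecker_one [Fintype n] {m' : ι → Type*}
    [∀ i, Fintype (m' i)] {K : ∀ i, Matrix (m' i) m R} (hK : ∑ i, (K i)ᴴ * K i = 1) :
    ∑ i, (K i ⊗ₖ (1 : Matrix n n R))ᴴ * (K i ⊗ₖ (1 : Matrix n n R)) = 1 := by
  simp only [conjTranspose_kronecker, ← mul_kronecker_mul, conjTranspose_one, Matrix.mul_one]
  rw [← sum_kronecker, hK, one_kronecker_one]

theorem sum_conjTranspose_mul_one_kronecker [Fintype m] {n' : ι → Type*}
    [∀ i, Fintype (n' i)] {K : ∀ i, Matrix (n' i) n R} (hK : ∑ i, (K i)ᴴ * K i = 1) :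
    ∑ i, ((1 : Matrix m m R) ⊗ₖ K i)ᴴ * ((1 : Matrix m m R) ⊗ₖ K i) = 1 := by
  simp only [conjTranspose_kronecker, ← mul_kronecker_mul, conjTranspose_one, Matrix.mul_one]
  rw [← kronecker_sum, hK, one_kronecker_one]

end Kronecker

section ReducedState

variable {𝕜 m n : Type*} [RCLike 𝕜] [Fintype m]

/-- The reduced operator `Tr₁ |φ⟩⟨φ|` on the second factor of a vector `φ` in `𝕜^m ⊗ 𝕜^n`. It is
a multiple of the identity when `φ` is maximally entangled. -/
def reducedState (φ : m × n → 𝕜) : Matrix n n 𝕜 :=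
  of fun j j' => ∑ i, φ (i, j) * star (φ (i, j'))

theorem reducedState_vec (V : Matrix n m 𝕜) : reducedState (vec V) = V * Vᴴ :=
  rfl

end ReducedState

section SeparableCone

variable {𝕜 m n m' n' : Type*} [RCLike 𝕜]

variable (𝕜 m n) in
/-- The cone of separable operators on `𝕜^m ⊗ 𝕜^n`: finite sums of tensor products of positive
semidefinite matrices. Positive multiples need not be added, as they can be absorbed into a
factor. -/
def separableCone : AddSubmonoid (Matrix (m × n) (m × n) 𝕜) :=
  AddSubmonoid.closure {M | ∃ A B, A.PosSemidef ∧ B.PosSemidef ∧ M = A ⊗ₖ B}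

theorem one_mem_separableCone [DecidableEq m] [DecidableEq n] : 1 ∈ separableCone 𝕜 m n :=
  AddSubmonoid.subset_closure ⟨1, 1, .one, .one, one_kronecker_one.symm⟩

variable [Fintype m] [Fintype n]

theorem conj_kronecker_mem_separableCone [Finite m'] [Finite n'] {M : Matrix (m × n) (m × n) 𝕜}
    (hM : M ∈ separableCone 𝕜 m n) (K : Matrix m m' 𝕜) (L : Matrix n n' 𝕜) :
    (K ⊗ₖ L)ᴴ * M * (K ⊗ₖ L) ∈ separableCone 𝕜 m' n' := by
  induction hM using AddSubmonoid.closure_induction with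
  | mem M h =>
    obtain ⟨A, B, hA, hB, rfl⟩ := h
    refine AddSubmonoid.subset_closure ⟨Kᴴ * A * K, Lᴴ * B * L,
      hA.conjTranspose_mul_mul_same K, hB.conjTranspose_mul_mul_same L, ?_⟩
    rw [conjTranspose_kronecker, mul_kronecker_mul, mul_kronecker_mul]
  | zero => simp only [Matrix.mul_zero, Matrix.zero_mul, zero_mem]
  | add M N _ _ hM hN =>
    rw [Matrix.mul_add, Matrix.add_mul]
    exact add_mem hM hN

variable [DecidableEq n] {φ : m × n → 𝕜} {c : 𝕜}

theorem expectation_kronecker_le (hφ : reducedState φ = c • 1) {A : Matrix m m 𝕜}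
    {B : Matrix n n 𝕜} (hA : A.PosSemidef) (hB : B.PosSemidef) :
    star φ ⬝ᵥ (A ⊗ₖ B) *ᵥ φ ≤ c * (A ⊗ₖ B).trace := by
  obtain ⟨V, rfl⟩ := vec_bijective.surjective φ
  rw [reducedState_vec] at hφ
  calc star (vec V) ⬝ᵥ (A ⊗ₖ B) *ᵥ vec V
      = (Vᴴ * B * V * Aᵀ).trace := star_vec_dotProduct_kronecker_mulVec_vec A B V
    _ ≤ (Vᴴ * B * V).trace * Aᵀ.trace :=
        trace_mul_le_trace_mul_trace (hB.conjTranspose_mul_mul_same V) hA.transpose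
    _ = (V * Vᴴ * B).trace * A.trace := by
        rw [trace_mul_comm, ← Matrix.mul_assoc, trace_transpose]
    _ = c * (A ⊗ₖ B).trace := by
        rw [hφ, smul_mul, Matrix.one_mul, trace_smul, smul_eq_mul, trace_kronecker]
        ring

theorem expectation_le_of_mem_separableCone (hφ : reducedState φ = c • 1)
    {M : Matrix (m × n) (m × n) 𝕜} (hM : M ∈ separableCone 𝕜 m n) :
    star φ ⬝ᵥ M *ᵥ φ ≤ c * M.trace := by
  induction hM using AddSubmonoid.closure_induction with
  | mem M h =>
    obtain ⟨A, B, hA, hB, rfl⟩ := h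
    exact expectation_kronecker_le hφ hA hB
  | zero => simp only [zero_mulVec, dotProduct_zero, trace_zero, mul_zero, le_refl]
  | add M N _ _ hM hN =>
    rw [add_mulVec, dotProduct_add, trace_add, mul_add]
    exact add_le_add hM hN

theorem expectation_le_of_mem_closure_separableCone (hφ : reducedState φ = c • 1)
    {M : Matrix (m × n) (m × n) 𝕜} (hM : M ∈ closure (separableCone 𝕜 m n : Set _)) :
    star φ ⬝ᵥ M *ᵥ φ ≤ c * M.trace := by
  have isClosed_bound : IsClosed {M : Matrix (m × n) (m × n) 𝕜 | star φ ⬝ᵥ M *ᵥ φ ≤ c * M.trace} :=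
    isClosed_le (by fun_prop) (by fun_prop)
  exact closure_minimal (fun _ => expectation_le_of_mem_separableCone hφ) isClosed_bound hM

end SeparableCone

section LOCC

variable {X : Type} [DecidableEq X] {a b : ℕ}

theorem Protocol.povm_mem_separableCone (T : Protocol X a b) (x : X) :
    T.povm x ∈ separableCone ℂ (Fin a) (Fin b) := by
  induction T with
  | output y =>
    rw [Protocol.povm]
    split_ifs
    · exact one_mem_separableCone
    · exact zero_mem _
  | alice a' K hK next ih =>
    rw [Protocol.povm]
    exact sum_mem fun i _ => conj_kronecker_mem_separableCone (ih i) _ _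
  | bob b' K hK next ih =>
    rw [Protocol.povm]
    exact sum_mem fun i _ => conj_kronecker_mem_separableCone (ih i) _ _

theorem Protocol.sum_povm [Fintype X] (T : Protocol X a b) : ∑ x, T.povm x = 1 := by
  induction T with
  | output y => simp only [Protocol.povm, Finset.sum_ite_eq', Finset.mem_univ, if_true]
  | alice a' K hK next ih =>
    simp only [Protocol.povm]
    rw [Finset.sum_comm]
    simp only [← Matrix.sum_mul, ← Matrix.mul_sum, ih, Matrix.mul_one]
    exact sum_conjTranspose_mul_kronecker_one hK
  | bob b' K hK next ih =>
    simp only [Protocol.povm]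
    rw [Finset.sum_comm]
    simp only [← Matrix.sum_mul, ← Matrix.mul_sum, ih, Matrix.mul_one]
    exact sum_conjTranspose_mul_one_kronecker hK

variable {E : X → Matrix (Fin a × Fin b) (Fin a × Fin b) ℂ}

theorem IsLOCC.mem_closure_separableCone (hE : IsLOCC E) (x : X) :
    E x ∈ closure (separableCone ℂ (Fin a) (Fin b) : Set _) := by
  obtain ⟨T, -, hT⟩ := hE
  exact mem_closure_of_tendsto (hT x) (.of_forall fun t => (T t).povm_mem_separableCone x)

theorem IsLOCC.sum_eq_one [Fintype X] (hE : IsLOCC E) : ∑ x, E x = 1 := by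
  obtain ⟨T, -, hT⟩ := hE
  refine tendsto_nhds_unique (tendsto_finsetSum _ fun x _ => hT x) ?_
  simp only [Protocol.sum_povm]
  exact tendsto_const_nhds

end LOCC

section MaximallyEntangled

variable {d n k : ℕ}

theorem Gam_eq_vec (d : ℕ) : Gam d = vec (((1 / Real.sqrt d : ℝ) : ℂ) • 1) := by
  ext ⟨i, j⟩
  simp only [Gam, vec, Matrix.smul_apply, one_apply, smul_eq_mul, mul_ite, mul_one, mul_zero,
    eq_comm]

theorem IsMaximallyEntangled.reducedState_eq {φ : EuclideanSpace ℂ (Fin d × Fin d)}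
    (hφ : IsMaximallyEntangled φ) : reducedState ⇑φ = (d : ℂ)⁻¹ • 1 := by
  obtain ⟨U, hU, rfl⟩ := hφ
  have normalization :
      ((1 / Real.sqrt d : ℝ) : ℂ) * star ((1 / Real.sqrt d : ℝ) : ℂ) = (d : ℂ)⁻¹ := by
    rw [Complex.star_def, Complex.conj_ofReal, ← Complex.ofReal_mul, div_mul_div_comm,
      Real.mul_self_sqrt d.cast_nonneg]
    push_cast
    rw [one_mul, one_div]
  have unitary : Uᵀ * Uᵀᴴ = 1 :=
    mem_unitaryGroup_iff.1 (transpose_mem_unitaryGroup_iff.2 hU)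
  simp only [Gam_eq_vec, kronecker_mulVec_vec, reducedState_vec]
  rw [Matrix.one_mul, smul_mul, Matrix.one_mul, conjTranspose_smul, smul_mul, Matrix.mul_smul,
    smul_smul, normalization, unitary]

theorem reducedState_sharedVector_apply (φ : Fin k → EuclideanSpace ℂ (Fin d × Fin d))
    (j j' : Fin (d ^ k)) :
    reducedState (sharedVector φ) j j' = ∏ x, reducedState ⇑(φ x)
      (finFunctionFinEquiv.symm j x) (finFunctionFinEquiv.symm j' x) := by
  simp only [reducedState, of_apply, sharedVector, star_prod, ← Finset.prod_mul_distrib]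
  rw [Fintype.prod_sum, ← finFunctionFinEquiv.symm.sum_comp]

theorem reducedState_sharedVector {φ : Fin k → EuclideanSpace ℂ (Fin d × Fin d)} {c : Fin k → ℂ}
    (hφ : ∀ x, reducedState ⇑(φ x) = c x • 1) :
    reducedState (sharedVector φ) = (∏ x, c x) • 1 := by
  ext j j'
  rw [reducedState_sharedVector_apply]
  simp only [hφ, Matrix.smul_apply, smul_eq_mul, Finset.prod_mul_distrib]
  congr 1
  rcases eq_or_ne j j' with rfl | hne
  · simp only [one_apply_eq, Finset.prod_const_one]
  · obtain ⟨x, hx⟩ := Function.ne_iff.1 (finFunctionFinEquiv.symm.injective.ne hne)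
    rw [one_apply_ne hne]
    exact Finset.prod_eq_zero (Finset.mem_univ x) (one_apply_ne hx)

theorem trace_subsetState_mul_le {ψ : Fin n → EuclideanSpace ℂ (Fin d × Fin d)} {c : ℂ}
    (hψ : ∀ i, reducedState ⇑(ψ i) = c • 1) {s : Finset (Fin n)} (hs : s.card = k)
    {M : Matrix (Fin (d ^ k) × Fin (d ^ k)) (Fin (d ^ k) × Fin (d ^ k)) ℂ}
    (hM : M ∈ closure (separableCone ℂ (Fin (d ^ k)) (Fin (d ^ k)) : Set _)) :
    (subsetState k ψ s * M).trace ≤ c ^ k * M.trace := by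
  have ordering_le (σ : Fin k ≃ s) :
      (vecMulVec (sharedVector fun j => ψ (σ j)) (star (sharedVector fun j => ψ (σ j))) * M).trace
        ≤ c ^ k * M.trace := by
    rw [vecMulVec_mul, trace_vecMulVec, dotProduct_comm, ← dotProduct_mulVec]
    have reduced := reducedState_sharedVector fun j => hψ (σ j)
    rw [Finset.prod_const, Finset.card_univ, Fintype.card_fin] at reduced
    exact expectation_le_of_mem_closure_separableCone reduced hM
  have card_orderings : Fintype.card (Fin k ≃ s) = k.factorial := by
    rw [Fintype.card_equiv (s.equivFinOfCardEq hs).symm, Fintype.card_fin]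
  have factorial_pos : (0 : ℂ) < k.factorial := mod_cast k.factorial_pos
  rw [subsetState, smul_mul, trace_smul, Finset.sum_mul, trace_sum, smul_eq_mul, one_div,
    inv_mul_le_iff₀ factorial_pos, ← nsmul_eq_mul, ← card_orderings, ← Finset.card_univ]
  exact Finset.sum_le_card_nsmul _ _ _ fun σ _ => ordering_le σ

theorem IsLOCC.sum_trace_subsetState_mul_le {ψ : Fin n → EuclideanSpace ℂ (Fin d × Fin d)}
    (hψ : ∀ i, IsMaximallyEntangled (ψ i))
    {E : {s : Finset (Fin n) // s.card = k} →
      Matrix (Fin (d ^ k) × Fin (d ^ k)) (Fin (d ^ k) × Fin (d ^ k)) ℂ} (hE : IsLOCC E) :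
    ∑ s, (subsetState k ψ s.1 * E s).trace ≤ (d : ℂ) ^ k :=
  calc ∑ s, (subsetState k ψ s.1 * E s).trace
      ≤ ∑ s, (d : ℂ)⁻¹ ^ k * (E s).trace :=
        Finset.sum_le_sum fun s _ => trace_subsetState_mul_le (fun i => (hψ i).reducedState_eq) s.2
          (hE.mem_closure_separableCone s)
    _ = ((d : ℂ) ^ k)⁻¹ * (d : ℂ) ^ k * (d : ℂ) ^ k := by
        rw [← Finset.mul_sum, ← trace_sum, hE.sum_eq_one, trace_one, Fintype.card_prod,
          Fintype.card_fin, inv_pow, mul_assoc, Nat.cast_mul, Nat.cast_pow]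
    _ = (d : ℂ) ^ k := inv_mul_mul_self _

end MaximallyEntangled

theorem lt_choose_two {n : ℕ} (hn : 4 ≤ n) : n < n.choose 2 := by
  induction n, hn using Nat.le_induction with
  | base => decide
  | succ n hn ih =>
    calc n + 1 < n + n.choose 2 := by omega
      _ = (n + 1).choose 2 := by rw [Nat.choose_succ_succ' n 1, Nat.choose_one_right]

end LocalSubset

open scoped ComplexOrder in
theorem mainTheorem6_general {d n k : ℕ} {ψ : Fin n → EuclideanSpace ℂ (Fin d × Fin d)}
    (hψ : ∀ i, LocalSubset.IsMaximallyEntangled (ψ i)) (hk : d ^ k < n.choose k) :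
    ¬ LocalSubset.IsLocallyIdentifiable ψ k := by
  rintro ⟨E, hE, identifies⟩
  have total_le := hE.sum_trace_subsetState_mul_le hψ
  simp only [identifies, Finset.sum_const, Finset.card_univ, Fintype.card_finset_len,
    Fintype.card_fin, nsmul_eq_mul, mul_one, ← Nat.cast_pow, Nat.cast_le] at total_le
  exact hk.not_ge total_le

theorem mainTheorem6 (d : ℕ) (hd : 2 ≤ d)
    (ψ : OrthonormalBasis (Fin (d ^ 2)) ℂ (EuclideanSpace ℂ (Fin d × Fin d)))
    (hψ : ∀ i, LocalSubset.IsMaximallyEntangled (ψ i)) :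
    ¬ LocalSubset.IsLocallyIdentifiable (fun i => ψ i) 2 :=
  mainTheorem6_general hψ (LocalSubset.lt_choose_two (Nat.pow_le_pow_left hd 2))
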